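/- Let $n$ be a positive integer, let $A$ and $B$ be $n\times n$ complex (Hermitian) positive semidefinite matrices, let $1\le k\le n$, and let $1\le i_1<i_2<\cdots<i_k\le n$ be any strictly increasing sequence of indices. For a Hermitian matrix $X\in\mathbb{C}^{n\times n}$ let $\lambda_1(X)\ge\lambda_2(X)\ge\cdots\ge\lambda_n(X)$ denote its eigenvalues, counted with multiplicity and arranged in decreasing order. Then $$\prod_{t=1}^k\lambda_{i_t}(A+B)^{1/k}\;\ge\;\prod_{t=1}^k\lambda_{i_t}(A)^{1/k}+\prod_{t=1}^k\lambda_{n-t+1}(B)^{1/k}$$ and $$\prod_{t=1}^k\lambda_{i_t}(A+B)\;\ge\;\prod_{t=1}^k\lambda_{i_t}(A)+\prod_{t=1}^k\lambda_{n-t+1}(B)+(2^k-2)\prod_{t=1}^k\bigl[\lambda_{i_t}(A)\,\lambda_{n-t+1}(B)\bigr]^{1/2}.$$ -/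

import Mathlib

open scoped Matrix ComplexOrder

/-- The eigenvalues of a Hermitian `n × n` complex matrix, counted with multiplicity and listed in
decreasing order: with 0-based indices, `sortedEigenvalue hA j` is `λ_{j+1}(A)`. -/
noncomputable def sortedEigenvalue {n : ℕ} {A : Matrix (Fin n) (Fin n) ℂ} (hA : A.IsHermitian)
    (j : Fin n) : ℝ :=
  hA.eigenvalues₀ (Fin.cast (Fintype.card_fin n).symm j)

theorem sortedEigenvalue_antitone {n : ℕ} {A : Matrix (Fin n) (Fin n) ℂ} (hA : A.IsHermitian) :
    Antitone (sortedEigenvalue hA) :=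
  fun _ _ h => hA.eigenvalues₀_antitone h

theorem roots_charpoly_eq_sortedEigenvalue {n : ℕ} {A : Matrix (Fin n) (Fin n) ℂ}
    (hA : A.IsHermitian) :
    A.charpoly.roots = Finset.univ.val.map (fun j => (sortedEigenvalue hA j : ℂ)) := by
  rw [hA.roots_charpoly_eq_eigenvalues₀,
    ← Finset.map_univ_equiv (finCongr (Fintype.card_fin n).symm), Finset.map_val, Multiset.map_map]
  rfl

/-! Compress to a well-chosen `k`-dimensional subspace `W` and apply Minkowski's determinant
inequality there. Wielandt's lemma (`exists_submodule_inf_finrank`) makes `W` meet the leading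
eigenspaces of `A` and the trailing eigenspaces of `A + B`, cut at the prescribed indices, in large
dimension. By Courant–Fischer, the determinants of the compressions of `A` and `A + B` are then
bounded below and above, respectively, by the products at these indices; for `B` any `W` of
dimension `k` works, with the smallest eigenvalues. Minkowski (`minkowski_det`) gives the first
inequality. The second follows from it by the scalar inequality `le_of_rpow_inv_add_le`. -/

/-! ### Wielandt's subspace lemma -/

/-- Enlarging a subspace by one dimension so that its intersections with all members of a decreasing
chain grow. -/
theorem exists_sup_span_singleton_inf_finrank {K V : Type*} [Field K] [AddCommGroup V] [Module K V]
    [FiniteDimensional K V] {k : ℕ} {T : ℕ → Submodule K V}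
    (hT : ∀ s t, s ≤ t → t ≤ k → T t ≤ T s)
    (hTdim : ∀ t ≤ k, k + 1 ≤ Module.finrank K (T t) + t)
    {U : Submodule K V} (hU : Module.finrank K U = k)
    (hUT : ∀ t < k, k ≤ Module.finrank K (U ⊓ T t : Submodule K V) + t) :
    ∃ u ∈ T 0, Module.finrank K (U ⊔ K ∙ u : Submodule K V) = k + 1 ∧
      ∀ t ≤ k, k + 1 ≤ Module.finrank K ((U ⊔ K ∙ u) ⊓ T t : Submodule K V) + t := by
  classical
  have h0 : ¬ T 0 ≤ U := fun h => by
    have h1 := Submodule.finrank_mono h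
    have h2 := hTdim 0 (Nat.zero_le _)
    omega
  -- A vector of `T j` outside `U`, with `j` maximal, raises the dimension of every intersection up
  -- to `j`; beyond `j` the whole of `T t` already lies in `U`.
  set j := Nat.findGreatest (fun j => ¬ T j ≤ U) k with hj
  have hjU : ¬ T j ≤ U := Nat.findGreatest_spec (P := fun j => ¬ T j ≤ U) (Nat.zero_le k) h0
  have hjk : j ≤ k := Nat.findGreatest_le k
  obtain ⟨u, huT, huU⟩ := SetLike.not_le_iff_exists.1 hjU
  refine ⟨u, hT 0 j (Nat.zero_le _) hjk huT, ?_, fun t ht => ?_⟩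
  · rw [Submodule.finrank_sup_span_singleton huU, hU]
  · rcases le_or_gt t j with htj | htj
    · have huTt : u ∈ T t := hT t j htj hjk huT
      have hle : (U ⊓ T t) ⊔ K ∙ u ≤ (U ⊔ K ∙ u) ⊓ T t :=
        sup_le (inf_le_inf_right _ le_sup_left)
          (le_inf le_sup_right ((Submodule.span_singleton_le_iff_mem _ _).2 huTt))
      have h1 := Submodule.finrank_mono hle
      rw [Submodule.finrank_sup_span_singleton (fun h => huU (Submodule.mem_inf.1 h).1)] at h1
      rcases ht.lt_or_eq with htk | rfl
      · have h2 := hUT t htk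
        omega
      · omega
    · have hTU : T t ≤ U := by
        by_contra h
        exact Nat.findGreatest_is_greatest htj ht h
      have h1 : T t ≤ (U ⊔ K ∙ u) ⊓ T t := le_inf (hTU.trans le_sup_left) le_rfl
      have h2 := Submodule.finrank_mono h1
      have h3 := hTdim t ht
      omega

/-- **Wielandt's subspace lemma**: an increasing chain `S` and a decreasing chain `T` of subspaces in
general enough position admit a subspace meeting every member of both chains in large dimension. -/
theorem exists_submodule_inf_finrank {K V : Type*} [Field K] [AddCommGroup V] [Module K V]
    [FiniteDimensional K V] (S T : ℕ → Submodule K V) (k : ℕ)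
    (hS : ∀ s t, s ≤ t → t < k → S s ≤ S t) (hT : ∀ s t, s ≤ t → t < k → T t ≤ T s)
    (hST : ∀ s t, s ≤ t → t < k → t + 1 ≤ Module.finrank K (S t ⊓ T s : Submodule K V) + s) :
    ∃ W : Submodule K V, Module.finrank K W = k ∧
      (∀ t < k, t + 1 ≤ Module.finrank K (W ⊓ S t : Submodule K V)) ∧
      (∀ t < k, k ≤ Module.finrank K (W ⊓ T t : Submodule K V) + t) := by
  induction k with
  | zero => exact ⟨⊥, by simp, by simp, by simp⟩
  | succ k ih =>
    obtain ⟨U, hU, hUS, hUT⟩ := ih (fun s t h h' => hS s t h (by omega))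
      (fun s t h h' => hT s t h (by omega)) (fun s t h h' => hST s t h (by omega))
    -- For `k > 0`, `U` meets the preceding member of the chain in its full dimension, hence lies in
    -- it.
    have hUle : U ≤ S k := by
      rcases k with _ | k
      · rw [Submodule.finrank_eq_zero.1 hU]; exact bot_le
      · have h1 : U ⊓ S k = U := Submodule.eq_of_le_of_finrank_le inf_le_left
          (by rw [hU]; exact hUS k (by omega))
        exact (inf_eq_left.1 h1).trans (hS k (k + 1) (by omega) (by omega))
    -- Cutting the decreasing chain down to `S k` forces the new vector into `S k`.
    obtain ⟨u, hu, hdim, hW⟩ := exists_sup_span_singleton_inf_finrank (T := fun t => S k ⊓ T t)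
      (k := k) (fun s t h h' => inf_le_inf_left _ (hT s t h (by omega)))
      (fun t h => hST t k h (by omega)) hU
      (fun t h => by rw [← inf_assoc, inf_eq_left.2 hUle]; exact hUT t h)
    have hWS : U ⊔ K ∙ u ≤ S k :=
      sup_le hUle ((Submodule.span_singleton_le_iff_mem _ _).2 hu.1)
    refine ⟨U ⊔ K ∙ u, hdim, fun t ht => ?_, fun t ht => ?_⟩
    · rcases (Nat.lt_succ_iff.1 ht).lt_or_eq with h | rfl
      · exact (hUS t h).trans (Submodule.finrank_mono (inf_le_inf_right _ le_sup_left))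
      · rw [inf_eq_left.2 hWS, hdim]
    · have h1 := hW t (by omega)
      rwa [← inf_assoc, inf_eq_left.2 hWS] at h1

/-! ### Eigenvector spans and Courant–Fischer -/

/-- An orthonormal family of eigenvectors belonging to the decreasingly ordered eigenvalues. -/
noncomputable def sortedEigenvector {n : ℕ} {A : Matrix (Fin n) (Fin n) ℂ} (hA : A.IsHermitian)
    (j : Fin n) : Fin n → ℂ :=
  WithLp.ofLp ((Matrix.isSymmetric_toEuclideanLin_iff.mpr hA).eigenvectorBasis
    finrank_euclideanSpace (Fin.cast (Fintype.card_fin n).symm j))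

section Spectral

variable {n : ℕ} {A : Matrix (Fin n) (Fin n) ℂ} (hA : A.IsHermitian)

theorem mulVec_sortedEigenvector (j : Fin n) :
    A *ᵥ sortedEigenvector hA j = (sortedEigenvalue hA j : ℂ) • sortedEigenvector hA j :=
  congrArg WithLp.ofLp ((Matrix.isSymmetric_toEuclideanLin_iff.mpr hA).apply_eigenvectorBasis
    finrank_euclideanSpace (Fin.cast (Fintype.card_fin n).symm j))

theorem star_sortedEigenvector_dotProduct (i j : Fin n) :
    star (sortedEigenvector hA i) ⬝ᵥ sortedEigenvector hA j = if i = j then 1 else 0 := by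
  have h := orthonormal_iff_ite.1 ((Matrix.isSymmetric_toEuclideanLin_iff.mpr hA).eigenvectorBasis
    finrank_euclideanSpace).orthonormal (Fin.cast (Fintype.card_fin n).symm i)
    (Fin.cast (Fintype.card_fin n).symm j)
  rw [EuclideanSpace.inner_eq_star_dotProduct, dotProduct_comm] at h
  simpa [sortedEigenvector] using h

theorem linearIndependent_sortedEigenvector : LinearIndependent ℂ (sortedEigenvector hA) := by
  rw [Fintype.linearIndependent_iff]
  intro g hg i
  have h := congrArg (fun x => star (sortedEigenvector hA i) ⬝ᵥ x) hg
  simpa [dotProduct_sum, star_sortedEigenvector_dotProduct] using h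

/-- The span of the eigenvectors with positions in `s`. -/
noncomputable def eigenvectorSpan (s : Finset (Fin n)) : Submodule ℂ (Fin n → ℂ) :=
  Submodule.span ℂ (Set.range fun j : s => sortedEigenvector hA j)

theorem finrank_eigenvectorSpan (s : Finset (Fin n)) :
    Module.finrank ℂ (eigenvectorSpan hA s) = s.card := by
  exact (finrank_span_eq_card ((linearIndependent_sortedEigenvector hA).comp
    ((↑) : s → Fin n) Subtype.val_injective)).trans (Fintype.card_coe s)

theorem eigenvectorSpan_mono {s t : Finset (Fin n)} (h : s ⊆ t) :
    eigenvectorSpan hA s ≤ eigenvectorSpan hA t := by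
  refine Submodule.span_mono ?_
  rintro _ ⟨j, rfl⟩
  exact ⟨⟨j, h j.2⟩, rfl⟩

theorem exists_coeff_of_mem_eigenvectorSpan {s : Finset (Fin n)} {x : Fin n → ℂ}
    (hx : x ∈ eigenvectorSpan hA s) : ∃ c : s → ℝ, (∀ j, 0 ≤ c j) ∧
      (star x ⬝ᵥ x).re = ∑ j, c j ∧ (star x ⬝ᵥ A *ᵥ x).re = ∑ j : s, sortedEigenvalue hA j * c j := by
  obtain ⟨c, rfl⟩ := (Submodule.mem_span_range_iff_exists_fun ℂ).1 hx
  -- Taking `f = 1` gives the squared norm, and `f` the eigenvalues gives the quadratic form.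
  have key : ∀ f : s → ℝ, (star (∑ j, c j • sortedEigenvector hA j) ⬝ᵥ
      ∑ j, (f j : ℂ) • c j • sortedEigenvector hA j).re = ∑ j, f j * Complex.normSq (c j) := by
    intro f
    rw [star_sum, sum_dotProduct, Complex.re_sum]
    refine Finset.sum_congr rfl fun i _ => ?_
    have : star (c i • sortedEigenvector hA i) ⬝ᵥ
        ∑ j, (f j : ℂ) • c j • sortedEigenvector hA j = ((f i * Complex.normSq (c i) : ℝ) : ℂ) := by
      simp only [dotProduct_sum, star_smul, smul_dotProduct, dotProduct_smul,
        star_sortedEigenvector_dotProduct, Subtype.coe_inj, smul_eq_mul, mul_ite, mul_one, mul_zero,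
        Finset.sum_ite_eq, Finset.mem_univ, if_true, Complex.ofReal_mul,
        Complex.normSq_eq_conj_mul_self]
      rw [Complex.star_def]
      ring
    rw [this, Complex.ofReal_re]
  refine ⟨fun j => Complex.normSq (c j), fun j => Complex.normSq_nonneg _, ?_, ?_⟩
  · simpa using key fun _ => 1
  · rw [← key, Matrix.mulVec_sum]
    simp only [Matrix.mulVec_smul, mulVec_sortedEigenvector, smul_comm (c _)]

theorem le_re_quadratic_of_mem_eigenvectorSpan {s : Finset (Fin n)} {x : Fin n → ℂ}
    (hx : x ∈ eigenvectorSpan hA s) {c : ℝ} (hc : ∀ j ∈ s, c ≤ sortedEigenvalue hA j) :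
    c * (star x ⬝ᵥ x).re ≤ (star x ⬝ᵥ A *ᵥ x).re := by
  obtain ⟨a, ha, h1, h2⟩ := exists_coeff_of_mem_eigenvectorSpan hA hx
  rw [h1, h2, Finset.mul_sum]
  exact Finset.sum_le_sum fun j _ => mul_le_mul_of_nonneg_right (hc j j.2) (ha j)

theorem re_quadratic_le_of_mem_eigenvectorSpan {s : Finset (Fin n)} {x : Fin n → ℂ}
    (hx : x ∈ eigenvectorSpan hA s) {c : ℝ} (hc : ∀ j ∈ s, sortedEigenvalue hA j ≤ c) :
    (star x ⬝ᵥ A *ᵥ x).re ≤ c * (star x ⬝ᵥ x).re := by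
  obtain ⟨a, ha, h1, h2⟩ := exists_coeff_of_mem_eigenvectorSpan hA hx
  rw [h1, h2, Finset.mul_sum]
  exact Finset.sum_le_sum fun j _ => mul_le_mul_of_nonneg_right (hc j j.2) (ha j)

theorem finrank_add_finrank_le_inf (X Y : Submodule ℂ (Fin n → ℂ)) :
    Module.finrank ℂ X + Module.finrank ℂ Y ≤ Module.finrank ℂ (X ⊓ Y : Submodule ℂ _) + n := by
  have h1 := Submodule.finrank_sup_add_finrank_inf_eq X Y
  have h2 := Submodule.finrank_le (X ⊔ Y)
  rw [Module.finrank_fin_fun] at h2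
  omega

theorem exists_ne_zero_mem_inf {X Y : Submodule ℂ (Fin n → ℂ)}
    (h : n < Module.finrank ℂ X + Module.finrank ℂ Y) :
    ∃ x ∈ X, x ∈ Y ∧ 0 < (star x ⬝ᵥ x).re := by
  have h1 := finrank_add_finrank_le_inf X Y
  have h2 : X ⊓ Y ≠ ⊥ := fun h0 => by
    rw [h0, finrank_bot] at h1
    omega
  obtain ⟨x, hx, hx0⟩ := Submodule.exists_mem_ne_zero_of_ne_bot h2
  exact ⟨x, (Submodule.mem_inf.1 hx).1, (Submodule.mem_inf.1 hx).2,
    (Complex.pos_iff.1 (Matrix.dotProduct_star_self_pos_iff.2 hx0)).1⟩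

/-- **Courant–Fischer**, lower bound. -/
theorem le_sortedEigenvalue_of_forall_mem {X : Submodule ℂ (Fin n → ℂ)} {t : Fin n} {c : ℝ}
    (hX : (t : ℕ) + 1 ≤ Module.finrank ℂ X)
    (hc : ∀ x ∈ X, c * (star x ⬝ᵥ x).re ≤ (star x ⬝ᵥ A *ᵥ x).re) : c ≤ sortedEigenvalue hA t := by
  obtain ⟨x, hxX, hxY, hx⟩ := exists_ne_zero_mem_inf (X := X)
    (Y := eigenvectorSpan hA (Finset.Ici t)) (by
      rw [finrank_eigenvectorSpan, Fin.card_Ici]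
      omega)
  exact le_of_mul_le_mul_right ((hc x hxX).trans (re_quadratic_le_of_mem_eigenvectorSpan hA hxY
    fun j hj => sortedEigenvalue_antitone hA (Finset.mem_Ici.1 hj))) hx

/-- **Courant–Fischer**, upper bound. -/
theorem sortedEigenvalue_le_of_forall_mem {X : Submodule ℂ (Fin n → ℂ)} {t : Fin n} {c : ℝ}
    (hX : n ≤ Module.finrank ℂ X + t)
    (hc : ∀ x ∈ X, (star x ⬝ᵥ A *ᵥ x).re ≤ c * (star x ⬝ᵥ x).re) : sortedEigenvalue hA t ≤ c := by
  obtain ⟨x, hxX, hxY, hx⟩ := exists_ne_zero_mem_inf (X := X)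
    (Y := eigenvectorSpan hA (Finset.Iic t)) (by
      rw [finrank_eigenvectorSpan, Fin.card_Iic]
      omega)
  exact le_of_mul_le_mul_right ((le_re_quadratic_of_mem_eigenvectorSpan hA hxY
    fun j hj => sortedEigenvalue_antitone hA (Finset.mem_Iic.1 hj)).trans (hc x hxX)) hx

theorem prod_sortedEigenvalue_eq_det_re : ∏ j, sortedEigenvalue hA j = A.det.re := by
  have h := A.det_eq_prod_roots_charpoly
  rw [roots_charpoly_eq_sortedEigenvalue hA] at h
  change A.det = ∏ j, (sortedEigenvalue hA j : ℂ) at h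
  rw [h, ← Complex.ofReal_prod, Complex.ofReal_re]

theorem sortedEigenvalue_nonneg (hA : A.PosSemidef) (j : Fin n) :
    0 ≤ sortedEigenvalue hA.isHermitian j :=
  le_sortedEigenvalue_of_forall_mem _ (X := ⊤)
    (by rw [finrank_top, Module.finrank_fin_fun]; exact j.2)
    fun x _ => by rw [zero_mul]; exact hA.re_dotProduct_nonneg x

end Spectral

/-! ### Compressions to a subspace -/

section Compression

variable {n k : ℕ} {A : Matrix (Fin n) (Fin n) ℂ}

theorem exists_isometry_range_ge {W : Submodule ℂ (Fin n → ℂ)} (hW : Module.finrank ℂ W = k) :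
    ∃ V : Matrix (Fin n) (Fin k) ℂ, Vᴴ * V = 1 ∧ W ≤ LinearMap.range V.mulVecLin := by
  set e := (WithLp.linearEquiv 2 ℂ (Fin n → ℂ)).symm
  have hW' : Module.finrank ℂ (W.map e.toLinearMap) = k :=
    (LinearEquiv.finrank_map_eq e W).trans hW
  let b := (stdOrthonormalBasis ℂ (W.map e.toLinearMap)).reindex (finCongr hW')
  refine ⟨Matrix.of fun a j => (b j : EuclideanSpace ℂ (Fin n)) a, ?_, fun x hx => ?_⟩
  · ext i j
    have h := orthonormal_iff_ite.1 b.orthonormal i j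
    rw [Submodule.coe_inner, EuclideanSpace.inner_eq_star_dotProduct, dotProduct_comm] at h
    rw [Matrix.one_apply]
    exact h
  · have h := b.sum_repr ⟨e x, Submodule.mem_map_of_mem hx⟩
    refine ⟨fun j => b.repr ⟨e x, Submodule.mem_map_of_mem hx⟩ j, ?_⟩
    ext a
    have h2 := congrArg (fun y : W.map e.toLinearMap => (y : EuclideanSpace ℂ (Fin n)) a) h
    simp only [Submodule.coe_sum, Submodule.coe_smul, WithLp.ofLp_sum, Finset.sum_apply,
      WithLp.ofLp_smul, Pi.smul_apply, smul_eq_mul] at h2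
    rw [Matrix.mulVecLin_apply, Matrix.mulVec, dotProduct]
    simp only [Matrix.of_apply, mul_comm ((b _ : EuclideanSpace ℂ (Fin n)) a)]
    exact h2

/-- The preimage of `S` maps onto a space containing `W ⊓ S`, so dimension counts in `W` transfer to
the domain of the compression. -/
theorem finrank_inf_le_finrank_comap {V : Matrix (Fin n) (Fin k) ℂ} {W : Submodule ℂ (Fin n → ℂ)}
    (hW : W ≤ LinearMap.range V.mulVecLin) (S : Submodule ℂ (Fin n → ℂ)) :
    Module.finrank ℂ (W ⊓ S : Submodule ℂ _) ≤ Module.finrank ℂ (S.comap V.mulVecLin) := by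
  refine le_trans (Submodule.finrank_mono ?_) (Submodule.finrank_map_le V.mulVecLin _)
  rw [Submodule.map_comap_eq]
  exact inf_le_inf_right _ hW

theorem star_dotProduct_compression (V : Matrix (Fin n) (Fin k) ℂ) (x : Fin k → ℂ) :
    star x ⬝ᵥ (Vᴴ * A * V) *ᵥ x = star (V *ᵥ x) ⬝ᵥ A *ᵥ (V *ᵥ x) := by
  rw [Matrix.star_mulVec, ← Matrix.dotProduct_mulVec, Matrix.mulVec_mulVec, Matrix.mulVec_mulVec,
    Matrix.mul_assoc]

theorem star_mulVec_dotProduct_self {V : Matrix (Fin n) (Fin k) ℂ} (hV : Vᴴ * V = 1)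
    (x : Fin k → ℂ) : star (V *ᵥ x) ⬝ᵥ (V *ᵥ x) = star x ⬝ᵥ x := by
  rw [Matrix.star_mulVec, ← Matrix.dotProduct_mulVec, Matrix.mulVec_mulVec, hV, Matrix.one_mulVec]

theorem sortedEigenvalue_le_compression {V : Matrix (Fin n) (Fin k) ℂ} (hV : Vᴴ * V = 1)
    {W : Submodule ℂ (Fin n → ℂ)} (hW : W ≤ LinearMap.range V.mulVecLin)
    (hA : A.IsHermitian) (hVA : (Vᴴ * A * V).IsHermitian) (j : Fin n) (t : Fin k)
    (h : (t : ℕ) + 1 ≤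
      Module.finrank ℂ (W ⊓ eigenvectorSpan hA (Finset.Iic j) : Submodule ℂ _)) :
    sortedEigenvalue hA j ≤ sortedEigenvalue hVA t := by
  refine le_sortedEigenvalue_of_forall_mem hVA (h.trans (finrank_inf_le_finrank_comap hW _))
    fun x hx => ?_
  rw [star_dotProduct_compression, ← star_mulVec_dotProduct_self hV]
  exact le_re_quadratic_of_mem_eigenvectorSpan hA hx
    fun i hi => sortedEigenvalue_antitone hA (Finset.mem_Iic.1 hi)

theorem compression_le_sortedEigenvalue {V : Matrix (Fin n) (Fin k) ℂ} (hV : Vᴴ * V = 1)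
    {W : Submodule ℂ (Fin n → ℂ)} (hW : W ≤ LinearMap.range V.mulVecLin)
    (hA : A.IsHermitian) (hVA : (Vᴴ * A * V).IsHermitian) (j : Fin n) (t : Fin k)
    (h : k ≤ Module.finrank ℂ (W ⊓ eigenvectorSpan hA (Finset.Ici j) : Submodule ℂ _) + t) :
    sortedEigenvalue hVA t ≤ sortedEigenvalue hA j := by
  refine sortedEigenvalue_le_of_forall_mem hVA
    (h.trans (Nat.add_le_add_right (finrank_inf_le_finrank_comap hW _) _)) fun x hx => ?_
  rw [star_dotProduct_compression, ← star_mulVec_dotProduct_self hV]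
  exact re_quadratic_le_of_mem_eigenvectorSpan hA hx
    fun i hi => sortedEigenvalue_antitone hA (Finset.mem_Ici.1 hi)

end Compression

/-! ### Minkowski's determinant inequality -/

/-- AM–GM for the numbers `1 / (1 + x j)` and for `x j / (1 + x j)`: the two arithmetic means add up
to 1. -/
theorem one_add_prod_rpow_le {k : ℕ} (hk : k ≠ 0) (x : Fin k → ℝ) (hx : ∀ j, 0 ≤ x j) :
    1 + (∏ j, x j) ^ ((1 : ℝ) / k) ≤ (∏ j, (1 + x j)) ^ ((1 : ℝ) / k) := by
  have hk' : (0 : ℝ) < k := by positivity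
  have hpos : ∀ j, 0 < 1 + x j := fun j => by linarith [hx j]
  have hw : ∑ _j : Fin k, (1 : ℝ) / k = 1 := by simp; field_simp
  have hw0 : ∀ j ∈ (Finset.univ : Finset (Fin k)), (0 : ℝ) ≤ 1 / k := fun _ _ => by positivity
  have h1 := Real.geom_mean_le_arith_mean_weighted Finset.univ (fun _ => (1 : ℝ) / k)
    (fun j => 1 / (1 + x j)) hw0 hw (fun j _ => (one_div_pos.2 (hpos j)).le)
  have h2 := Real.geom_mean_le_arith_mean_weighted Finset.univ (fun _ => (1 : ℝ) / k)
    (fun j => x j / (1 + x j)) hw0 hw (fun j _ => div_nonneg (hx j) (hpos j).le)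
  have h3 : ∑ j : Fin k, (1 : ℝ) / k * (1 / (1 + x j))
      + ∑ j : Fin k, (1 : ℝ) / k * (x j / (1 + x j)) = 1 := by
    rw [← Finset.sum_add_distrib]
    refine Eq.trans ?_ hw
    refine Finset.sum_congr rfl fun j _ => ?_
    have := (hpos j).ne'
    field_simp
  rw [Real.finsetProd_rpow _ _ (fun j _ => (one_div_pos.2 (hpos j)).le), Finset.prod_div_distrib,
    Finset.prod_const_one,
    Real.div_rpow zero_le_one (Finset.prod_nonneg fun j _ => (hpos j).le), Real.one_rpow] at h1
  rw [Real.finsetProd_rpow _ _ (fun j _ => div_nonneg (hx j) (hpos j).le),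
    Finset.prod_div_distrib, Real.div_rpow (Finset.prod_nonneg fun j _ => hx j)
    (Finset.prod_nonneg fun j _ => (hpos j).le)] at h2
  have hP : 0 < (∏ j, (1 + x j)) ^ ((1 : ℝ) / k) :=
    Real.rpow_pos_of_pos (Finset.prod_pos fun j _ => hpos j) _
  have h4 := (add_le_add h1 h2).trans_eq h3
  rwa [← add_div, div_le_one hP] at h4

/-- Evaluate the characteristic polynomial at `-1`; the signs cancel. -/
theorem Matrix.IsHermitian.det_one_add_eq_prod {ι : Type*} [Fintype ι] [DecidableEq ι]
    {M : Matrix ι ι ℂ} (hM : M.IsHermitian) :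
    (1 + M).det = ∏ j, ((1 + hM.eigenvalues j : ℝ) : ℂ) := by
  have h := congrArg (Polynomial.eval (-1)) hM.charpoly_eq
  rw [Matrix.eval_charpoly, Polynomial.eval_prod] at h
  have h1 : Matrix.scalar ι (-1 : ℂ) - M = -(1 + M) := by
    rw [map_neg, map_one]; abel
  rw [h1, Matrix.det_neg] at h
  have h2 : ∏ j, Polynomial.eval (-1) (Polynomial.X - Polynomial.C (hM.eigenvalues j : ℂ))
      = (-1) ^ Fintype.card ι * ∏ j, ((1 + hM.eigenvalues j : ℝ) : ℂ) := by
    rw [← Finset.card_univ, ← Finset.prod_const, ← Finset.prod_mul_distrib]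
    refine Finset.prod_congr rfl fun j _ => ?_
    simp; ring
  have h3 := h.trans h2
  exact mul_left_cancel₀ (pow_ne_zero _ (by norm_num)) h3

/-- Writing `P = Sᴴ * S` with `S` invertible, congruence by `S⁻¹` reduces to `P = 1`, where the
claim is `one_add_prod_rpow_le` for the eigenvalues of `C`. -/
theorem minkowski_det_posDef {k : ℕ} (hk : k ≠ 0) {P Q : Matrix (Fin k) (Fin k) ℂ}
    (hP : P.PosDef) (hQ : Q.PosSemidef) :
    P.det.re ^ ((1 : ℝ) / k) + Q.det.re ^ ((1 : ℝ) / k) ≤ (P + Q).det.re ^ ((1 : ℝ) / k) := by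
  obtain ⟨S, hS⟩ : ∃ S, P = Sᴴ * S := by
    open scoped MatrixOrder in
    exact CStarAlgebra.nonneg_iff_eq_star_mul_self.1 hP.posSemidef.nonneg
  have hdetP : P.det = star S.det * S.det := by rw [hS, Matrix.det_mul, Matrix.det_conjTranspose]
  have hS0 : S.det ≠ 0 := fun h => hP.det_pos.ne' (by rw [hdetP, h, mul_zero])
  have hSu : IsUnit S.det := isUnit_iff_ne_zero.2 hS0
  set C := S⁻¹ᴴ * Q * S⁻¹ with hC
  have hCp : C.PosSemidef := hQ.conjTranspose_mul_mul_same _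
  have hQC : Q = Sᴴ * C * S := by
    rw [hC, Matrix.conjTranspose_nonsing_inv]
    have hSu' : IsUnit Sᴴ.det := by rw [Matrix.det_conjTranspose]; exact hSu.star
    rw [← Matrix.mul_assoc, ← Matrix.mul_assoc, Matrix.mul_nonsing_inv _ hSu', Matrix.one_mul,
      Matrix.mul_assoc, Matrix.nonsing_inv_mul _ hSu, Matrix.mul_one]
  have hPQ : P + Q = Sᴴ * (1 + C) * S := by
    rw [Matrix.mul_add, Matrix.add_mul, Matrix.mul_one, ← hS, ← hQC]
  have hdetQ : Q.det = P.det * C.det := by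
    rw [hQC, Matrix.det_mul, Matrix.det_mul, Matrix.det_conjTranspose, hdetP]; ring
  have hdetPQ : (P + Q).det = P.det * (1 + C).det := by
    rw [hPQ, Matrix.det_mul, Matrix.det_mul, Matrix.det_conjTranspose, hdetP]; ring
  have hPpos : 0 < P.det.re := (Complex.pos_iff.1 hP.det_pos).1
  have hPre : P.det = (P.det.re : ℂ) :=
    Complex.ext rfl (by simp [← (Complex.pos_iff.1 hP.det_pos).2])
  have hx := fun j => hCp.eigenvalues_nonneg j
  rw [hdetPQ, hdetQ, hCp.isHermitian.det_one_add_eq_prod, hCp.isHermitian.det_eq_prod_eigenvalues]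
  have e1 : (P.det * ∏ j, ((1 + hCp.isHermitian.eigenvalues j : ℝ) : ℂ)).re
      = P.det.re * ∏ j, (1 + hCp.isHermitian.eigenvalues j) := by
    rw [hPre, ← Complex.ofReal_prod, ← Complex.ofReal_mul, Complex.ofReal_re, Complex.ofReal_re]
  have e2 : (P.det * ∏ j, ((hCp.isHermitian.eigenvalues j : ℝ) : ℂ)).re
      = P.det.re * ∏ j, (hCp.isHermitian.eigenvalues j) := by
    rw [hPre, ← Complex.ofReal_prod, ← Complex.ofReal_mul, Complex.ofReal_re, Complex.ofReal_re]
  simp only [RCLike.ofReal_eq_complex_ofReal] at *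
  rw [e1, e2, Real.mul_rpow hPpos.le (Finset.prod_nonneg fun j _ => hx j),
    Real.mul_rpow hPpos.le (Finset.prod_nonneg fun j _ => by linarith [hx j])]
  have h := mul_le_mul_of_nonneg_left (one_add_prod_rpow_le hk _ hx)
    (Real.rpow_nonneg hPpos.le ((1 : ℝ) / k))
  linarith

/-- **Minkowski's determinant inequality** for positive semidefinite matrices. -/
theorem minkowski_det {k : ℕ} (hk : k ≠ 0) {P Q : Matrix (Fin k) (Fin k) ℂ}
    (hP : P.PosSemidef) (hQ : Q.PosSemidef) :
    P.det.re ^ ((1 : ℝ) / k) + Q.det.re ^ ((1 : ℝ) / k) ≤ (P + Q).det.re ^ ((1 : ℝ) / k) := by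
  by_cases hP0 : P.det = 0
  · by_cases hQ0 : Q.det = 0
    · have hk' : (1 : ℝ) / k ≠ 0 := by positivity
      rw [hP0, hQ0, Complex.zero_re, Real.zero_rpow hk', add_zero]
      exact Real.rpow_nonneg (Complex.nonneg_iff.1 (hP.add hQ).det_nonneg).1 _
    · rw [add_comm, add_comm P]
      exact minkowski_det_posDef hk (hQ.posDef_iff_det_ne_zero.2 hQ0) hP
  · exact minkowski_det_posDef hk (hP.posDef_iff_det_ne_zero.2 hP0) hQ

/-! ### The scalar inequality -/

theorem add_pow_ge_of_sq {u v : ℝ} (hu : 0 ≤ u) (hv : 0 ≤ v) {k : ℕ} (hk : 1 ≤ k) :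
    (u ^ 2) ^ k + (v ^ 2) ^ k + (2 ^ k - 2) * (u ^ k * v ^ k) ≤ (u ^ 2 + v ^ 2) ^ k := by
  induction k, hk using Nat.le_induction with
  | base => simp
  | succ k hk ih =>
    -- After multiplying by `u ^ 2 + v ^ 2`, the surplus over the required bound is exactly the sum
    -- of the terms in `h2` and `h3`.
    have h1 := mul_le_mul_of_nonneg_left ih (by positivity : 0 ≤ u ^ 2 + v ^ 2)
    have h2 : (0 : ℝ) ≤ (2 ^ k - 2) * (u ^ k * v ^ k) * (u - v) ^ 2 := by
      have h2k : (2 : ℝ) ≤ 2 ^ k := le_self_pow₀ (by norm_num) (by omega)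
      have := sub_nonneg.2 h2k
      positivity
    have h3 := sq_nonneg (u * v ^ k - v * u ^ k)
    have e1 : (u ^ 2) ^ k = (u ^ k) ^ 2 := by ring
    have e2 : (v ^ 2) ^ k = (v ^ k) ^ 2 := by ring
    rw [e1, e2] at h1
    have e3 : (u ^ 2) ^ (k + 1) = (u ^ k) ^ 2 * u ^ 2 := by ring
    have e4 : (v ^ 2) ^ (k + 1) = (v ^ k) ^ 2 * v ^ 2 := by ring
    rw [pow_succ' (u ^ 2 + v ^ 2), e3, e4, pow_succ u k, pow_succ v k, pow_succ (2 : ℝ) k]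
    linarith

/-- Apply `add_pow_ge_of_sq` with `u` and `v` the square roots of the `k`-th roots of `a` and `b`,
so that `u ^ k * v ^ k` is the square root of `a * b`. -/
theorem le_of_rpow_inv_add_le {a b c : ℝ} (ha : 0 ≤ a) (hb : 0 ≤ b) (hc : 0 ≤ c) {k : ℕ}
    (hk : 1 ≤ k) (h : a ^ ((1 : ℝ) / k) + b ^ ((1 : ℝ) / k) ≤ c ^ ((1 : ℝ) / k)) :
    a + b + (2 ^ k - 2) * (a * b) ^ ((1 : ℝ) / 2) ≤ c := by
  have hk0 : k ≠ 0 := by omega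
  have hroot : ∀ x : ℝ, 0 ≤ x → (x ^ ((1 : ℝ) / k)) ^ k = x := fun x hx => by
    rw [one_div, Real.rpow_inv_natCast_pow hx hk0]
  have hp := Real.rpow_nonneg ha ((1 : ℝ) / k)
  have hq := Real.rpow_nonneg hb ((1 : ℝ) / k)
  have h1 := add_pow_ge_of_sq (Real.sqrt_nonneg (a ^ ((1 : ℝ) / k)))
    (Real.sqrt_nonneg (b ^ ((1 : ℝ) / k))) hk
  have h2 := pow_le_pow_left₀ (add_nonneg hp hq) h k
  rw [hroot c hc] at h2
  rw [Real.sq_sqrt hp, Real.sq_sqrt hq, hroot a ha, hroot b hb] at h1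
  have h3 : √(a ^ ((1 : ℝ) / k)) ^ k * √(b ^ ((1 : ℝ) / k)) ^ k = (a * b) ^ ((1 : ℝ) / 2) := by
    rw [← Real.sqrt_eq_rpow, eq_comm, Real.sqrt_eq_iff_mul_self_eq (mul_nonneg ha hb)
      (by positivity), eq_comm]
    calc _ = (√(a ^ ((1 : ℝ) / k)) ^ 2) ^ k * (√(b ^ ((1 : ℝ) / k)) ^ 2) ^ k := by ring
      _ = a * b := by rw [Real.sq_sqrt hp, Real.sq_sqrt hq, hroot a ha, hroot b hb]
  rw [h3] at h1
  exact h1.trans h2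

/-! ### The adapted subspace and the main inequalities -/

theorem StrictMono.val_add_le_val_add {n k : ℕ} {i : Fin k → Fin n} (hi : StrictMono i)
    {s t : Fin k} (hst : s ≤ t) : (i s : ℕ) + t ≤ i t + s := by
  obtain ⟨s, hs⟩ := s
  obtain ⟨t, ht⟩ := t
  have hst' : s ≤ t := hst
  clear hst
  induction t, hst' using Nat.le_induction with
  | base => exact le_rfl
  | succ t hst ih =>
    have h1 : (i ⟨t, by omega⟩ : ℕ) < i ⟨t + 1, ht⟩ := hi (Nat.lt_succ_self t)
    have h2 := ih (by omega)
    simp only at h2 ⊢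
    omega

/-- A subspace adapted to the eigenvectors of two Hermitian matrices at prescribed positions. -/
theorem exists_submodule_inf_eigenvectorSpan {n k : ℕ} {A C : Matrix (Fin n) (Fin n) ℂ}
    (hA : A.IsHermitian) (hC : C.IsHermitian) {i : Fin k → Fin n} (hi : StrictMono i) :
    ∃ W : Submodule ℂ (Fin n → ℂ), Module.finrank ℂ W = k ∧
      (∀ t : Fin k, (t : ℕ) + 1 ≤
        Module.finrank ℂ (W ⊓ eigenvectorSpan hA (Finset.Iic (i t)) : Submodule ℂ _)) ∧
      (∀ t : Fin k, k ≤
        Module.finrank ℂ (W ⊓ eigenvectorSpan hC (Finset.Ici (i t)) : Submodule ℂ _) + t) := by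
  -- The value `⊤` from index `k` on is a filler that is never used.
  obtain ⟨W, hW, hWS, hWT⟩ := exists_submodule_inf_finrank
    (fun m => if h : m < k then eigenvectorSpan hA (Finset.Iic (i ⟨m, h⟩)) else ⊤)
    (fun m => if h : m < k then eigenvectorSpan hC (Finset.Ici (i ⟨m, h⟩)) else ⊤) k
    (fun s t hst ht => by
      simp only [ht, hst.trans_lt ht, dif_pos]
      exact eigenvectorSpan_mono hA (Finset.Iic_subset_Iic.2 (hi.monotone hst)))
    (fun s t hst ht => by
      simp only [ht, hst.trans_lt ht, dif_pos]
      exact eigenvectorSpan_mono hC (Finset.Ici_subset_Ici.2 (hi.monotone hst)))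
    (fun s t hst ht => by
      rw [dif_pos ht, dif_pos (hst.trans_lt ht)]
      have h1 := finrank_add_finrank_le_inf (eigenvectorSpan hA (Finset.Iic (i ⟨t, ht⟩)))
        (eigenvectorSpan hC (Finset.Ici (i ⟨s, hst.trans_lt ht⟩)))
      rw [finrank_eigenvectorSpan, finrank_eigenvectorSpan, Fin.card_Iic, Fin.card_Ici] at h1
      have h2 : (i ⟨s, hst.trans_lt ht⟩ : ℕ) + t ≤ i ⟨t, ht⟩ + s :=
        hi.val_add_le_val_add (s := ⟨s, hst.trans_lt ht⟩) (t := ⟨t, ht⟩) hst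
      omega)
  refine ⟨W, hW, fun t => ?_, fun t => ?_⟩
  · have h := hWS t t.2
    rwa [dif_pos t.2] at h
  · have h := hWT t t.2
    rwa [dif_pos t.2] at h

theorem prod_sortedEigenvalue_rpow_add_le {n k : ℕ} (hk : 1 ≤ k) (hkn : k ≤ n)
    {A B : Matrix (Fin n) (Fin n) ℂ} (hA : A.PosSemidef) (hB : B.PosSemidef)
    {i : Fin k → Fin n} (hi : StrictMono i) :
    (∏ t, sortedEigenvalue hA.isHermitian (i t)) ^ ((1 : ℝ) / k)
        + (∏ t, sortedEigenvalue hB.isHermitian (Fin.castLE hkn t).rev) ^ ((1 : ℝ) / k)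
      ≤ (∏ t, sortedEigenvalue (hA.add hB).isHermitian (i t)) ^ ((1 : ℝ) / k) := by
  obtain ⟨W, hW, hWA, hWC⟩ :=
    exists_submodule_inf_eigenvectorSpan hA.isHermitian (hA.add hB).isHermitian hi
  obtain ⟨V, hV, hWV⟩ := exists_isometry_range_ge hW
  have hVA := hA.conjTranspose_mul_mul_same V
  have hVB := hB.conjTranspose_mul_mul_same V
  have hVC := (hA.add hB).conjTranspose_mul_mul_same V
  have hexp : (0 : ℝ) ≤ 1 / k := by positivity
  have h1 : ∏ t, sortedEigenvalue hA.isHermitian (i t) ≤ (Vᴴ * A * V).det.re := by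
    rw [← prod_sortedEigenvalue_eq_det_re hVA.isHermitian]
    exact Finset.prod_le_prod (fun t _ => sortedEigenvalue_nonneg hA _)
      fun t _ => sortedEigenvalue_le_compression hV hWV _ _ _ _ (hWA t)
  have h2 : ∏ t, sortedEigenvalue hB.isHermitian (Fin.castLE hkn t).rev
      ≤ (Vᴴ * B * V).det.re := by
    -- Reversing the product pairs 0-based position `n - k + t` of `B` with position `t` of its
    -- compression; the dimension formula alone then suffices.
    rw [← prod_sortedEigenvalue_eq_det_re hVB.isHermitian, ← Equiv.prod_comp Fin.revPerm]
    refine Finset.prod_le_prod (fun t _ => sortedEigenvalue_nonneg hB _)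
      fun t _ => sortedEigenvalue_le_compression hV hWV _ _ _ _ ?_
    have h := finrank_add_finrank_le_inf W
      (eigenvectorSpan hB.isHermitian (Finset.Iic (Fin.castLE hkn (Fin.revPerm t)).rev))
    rw [hW, finrank_eigenvectorSpan, Fin.card_Iic] at h
    simp only [Fin.revPerm_apply, Fin.val_rev, Fin.val_castLE] at h ⊢
    omega
  have h3 : (Vᴴ * A * V + Vᴴ * B * V).det.re
      ≤ ∏ t, sortedEigenvalue (hA.add hB).isHermitian (i t) := by
    rw [← Matrix.add_mul, ← Matrix.mul_add, ← prod_sortedEigenvalue_eq_det_re hVC.isHermitian]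
    exact Finset.prod_le_prod (fun t _ => sortedEigenvalue_nonneg hVC _)
      fun t _ => compression_le_sortedEigenvalue hV hWV _ _ _ _ (hWC t)
  calc _ ≤ (Vᴴ * A * V).det.re ^ ((1 : ℝ) / k) + (Vᴴ * B * V).det.re ^ ((1 : ℝ) / k) :=
        add_le_add
          (Real.rpow_le_rpow (Finset.prod_nonneg fun t _ => sortedEigenvalue_nonneg hA _) h1 hexp)
          (Real.rpow_le_rpow (Finset.prod_nonneg fun t _ => sortedEigenvalue_nonneg hB _) h2 hexp)
    _ ≤ (Vᴴ * A * V + Vᴴ * B * V).det.re ^ ((1 : ℝ) / k) :=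
        minkowski_det (by omega) hVA hVB
    _ ≤ _ := Real.rpow_le_rpow
        (Complex.nonneg_iff.1 (hVA.add hVB).det_nonneg).1 h3 hexp

/-- Indices are 0-based: `i t` is `i_{t+1} - 1`, and `(Fin.castLE hkn t).rev = n - 1 - t` is the
position of `λ_{n-(t+1)+1}`. -/
theorem mainTheorem1 (n k : ℕ) (hk : 1 ≤ k) (hkn : k ≤ n)
    (A B : Matrix (Fin n) (Fin n) ℂ) (hA : A.PosSemidef) (hB : B.PosSemidef)
    (i : Fin k → Fin n) (hi : StrictMono i) :
    ((∏ t : Fin k, sortedEigenvalue hA.isHermitian (i t) ^ ((1 : ℝ) / (k : ℝ)))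
        + (∏ t : Fin k,
            sortedEigenvalue hB.isHermitian (Fin.castLE hkn t).rev ^ ((1 : ℝ) / (k : ℝ)))
      ≤ ∏ t : Fin k, sortedEigenvalue (hA.add hB).isHermitian (i t) ^ ((1 : ℝ) / (k : ℝ))) ∧
    ((∏ t : Fin k, sortedEigenvalue hA.isHermitian (i t))
        + (∏ t : Fin k, sortedEigenvalue hB.isHermitian (Fin.castLE hkn t).rev)
        + ((2 : ℝ) ^ k - 2) * ∏ t : Fin k, (sortedEigenvalue hA.isHermitian (i t)
            * sortedEigenvalue hB.isHermitian (Fin.castLE hkn t).rev) ^ ((1 : ℝ) / 2)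
      ≤ ∏ t : Fin k, sortedEigenvalue (hA.add hB).isHermitian (i t)) := by
  have h := prod_sortedEigenvalue_rpow_add_le hk hkn hA hB hi
  have hA0 := fun t => sortedEigenvalue_nonneg hA (i t)
  have hB0 := fun t => sortedEigenvalue_nonneg hB (Fin.castLE hkn t).rev
  have hC0 := fun t => sortedEigenvalue_nonneg (hA.add hB) (i t)
  constructor
  · rwa [Real.finsetProd_rpow _ _ fun t _ => hA0 t, Real.finsetProd_rpow _ _ fun t _ => hB0 t,
      Real.finsetProd_rpow _ _ fun t _ => hC0 t]
  · rw [Real.finsetProd_rpow _ _ fun t _ => mul_nonneg (hA0 t) (hB0 t), Finset.prod_mul_distrib]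
    exact le_of_rpow_inv_add_le (Finset.prod_nonneg fun t _ => hA0 t)
      (Finset.prod_nonneg fun t _ => hB0 t) (Finset.prod_nonneg fun t _ => hC0 t) hk h
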